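/- Let $T_h$ denote the complete binary tree of height $h$ (every vertex of level less than $h$ has a left and a right child; the $2^h$ vertices of level $h$ are the leaves). Let $b_1,\dots,b_{2^h}$ be its leaves in the canonical (left-to-right) order. Let the guest graph be $G=T_{h_G}$ with $h_G\ge 1$, and let the host graph be $T=T_{h_G+1}$. An arrangement is an injective map $\phi$ from $V(G)$ to the leaves of $T$, and its cost is $OV(\phi)=\sum_{\{u,v\}\in E(G)} d_T(\phi(u),\phi(v))$, where $d_T$ is the length of the unique path in $T$. Algorithm $\mathcal A$ computes a map $\phi_A$ recursively. For a guest tree of height $0$ the single vertex is put on $b_1$. For a guest tree of height $k\ge 1$ and host leaves $b_1,\dots,b_b$ with $b=2^{k+1}$: arrange the left basic subtree (the subtree of height $k-1$ rooted at the left child of the root) by $\mathcal A$ on $b_1,\dots,b_{b/2}$ and the right basic subtree (rooted at the right child) by $\mathcal A$ on $b_{b/2+1},\dots,b_b$; put the root on $b_{b/2}$; finally, if $k$ is odd and $k\ge 3$, exchange the vertices arranged on $b_{b/4-1}$ and $b_{b/2}$. Then for every $h_G\ge1$ the map $\phi_A$ produced by $\mathcal A$ is an arrangement, and $OV(\phi_A)\le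 \frac{203}{200}\,OV(\phi)$ for every arrangement $\phi$; that is, $\mathcal A$ is a $\frac{203}{200}$-approximation algorithm. -/

import Mathlib

/-- The vertices of the complete (regular) binary tree of height `h`: the binary words of length
at most `h`.  The empty word is the root, the level of a vertex is its length, and the left and
right children of `w` are `w ++ [false]` and `w ++ [true]`. -/
abbrev BTVertex (h : ℕ) : Type := {w : List Bool // w.length ≤ h}

noncomputable instance instFintypeBTVertex (h : ℕ) : Fintype (BTVertex h) :=
  Set.Finite.fintype (List.finite_length_le Bool h)

/-- `v` is a child of `u`. -/
def IsChild {h : ℕ} (u v : BTVertex h) : Prop := ∃ c : Bool, v.1 = u.1 ++ [c]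

/-- The complete (regular) binary tree of height `h`: its edges join each vertex to its children. -/
def completeBinaryTree (h : ℕ) : SimpleGraph (BTVertex h) where
  Adj u v := IsChild u v ∨ IsChild v u
  symm := ⟨fun _ _ huv => huv.symm⟩
  loopless := ⟨fun u hu => by
    have key : ¬ IsChild u u := by
      rintro ⟨c, hc⟩
      have := congrArg List.length hc
      simp at this
    exact hu.elim key key⟩

/-- The leaves of the complete binary tree of height `h` are its vertices of level `h`. -/
def IsLeaf {h : ℕ} (w : BTVertex h) : Prop := w.1.length = h

/-- The word of the `i`-th leaf `b_i` (`1 ≤ i ≤ 2 ^ h`) of the complete binary tree of height `h`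
in the canonical order: all leaves below the left child of the root precede all leaves below its
right child, and the leaves of both basic subtrees are ordered canonically. -/
def leafWord : ℕ → ℕ → List Bool
  | 0, _ => []
  | h + 1, i => if i ≤ 2 ^ h then false :: leafWord h i else true :: leafWord h (i - 2 ^ h)

theorem length_leafWord (h i : ℕ) : (leafWord h i).length = h := by
  induction h generalizing i with
  | zero => rfl
  | succ h ih =>
    unfold leafWord
    split <;> simp [ih]

/-- The `i`-th leaf `b_i` in the canonical order, `1 ≤ i ≤ 2 ^ h`. -/
def leaf (h i : ℕ) : BTVertex h := ⟨leafWord h i, (length_leafWord h i).le⟩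

/-- An arrangement of the guest tree of height `hG` on the host tree of height `hG + 1`:
an injective map from the vertices of the guest tree to the leaves of the host tree. -/
def IsArrangement {hG : ℕ} (φ : BTVertex hG → BTVertex (hG + 1)) : Prop :=
  Function.Injective φ ∧ ∀ v, IsLeaf (φ v)

open Classical in
/-- The objective value: the sum, over the edges `{u, v}` of the guest graph `G`, of the distance
of `φ u` and `φ v` in the host graph `T`. -/
noncomputable def objectiveValue {V W : Type} [Fintype V] (G : SimpleGraph V) (T : SimpleGraph W)
    (φ : V → W) : ℕ :=
  ∑ e ∈ G.edgeFinset,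
    Sym2.lift ⟨fun u v => T.dist (φ u) (φ v), fun _ _ => SimpleGraph.dist_comm⟩ e

/-- The objective value of an arrangement of the complete binary tree of height `hG` on the
leaves of the complete binary tree of height `hG + 1`. -/
noncomputable def OV {hG : ℕ} (φ : BTVertex hG → BTVertex (hG + 1)) : ℕ :=
  objectiveValue (completeBinaryTree hG) (completeBinaryTree (hG + 1)) φ

/-- The recursive algorithm: `algorithmA hG w` is the index `i` of the leaf `b_i` on which the
vertex `w` of the guest tree of height `hG` is arranged.  With `b = 2 ^ (hG + 1)` leaves, the left
and the right basic subtree are arranged recursively on the first and the last `b / 2` leaves, the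
root goes to the leaf with index `b / 2`, and if `hG` is odd and at least `3`, then the vertices on
the leaves with indices `b / 4 - 1` and `b / 2` are exchanged. -/
def algorithmA : ℕ → List Bool → ℕ
  | 0, _ => 1
  | k + 1, w =>
    let b : ℕ := 2 ^ (k + 2)
    let i : ℕ :=
      match w with
      | [] => b / 2
      | false :: w' => algorithmA k w'
      | true :: w' => b / 2 + algorithmA k w'
    if Odd (k + 1) ∧ 3 ≤ k + 1 then Equiv.swap (b / 4 - 1) (b / 2) i else i

/-- The arrangement computed by the algorithm. -/
def phiA (hG : ℕ) : BTVertex hG → BTVertex (hG + 1) :=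
  fun v => leaf (hG + 1) (algorithmA hG v.1)

/-!
Two leaves of the host tree of height `h = k + 1` have distance twice the number of levels `j` with
`1 ≤ j ≤ h` on which their ancestors differ. Hence the objective value of an arrangement is twice
the sum over `j` of the number of guest edges cut by the partition of the guest vertices into
`2 ^ j` parts, according to the ancestor of level `j` of the assigned leaf
(`placementCost_eq_sum_cutCount`). Each part has at most `2 ^ s` elements, where `s = h - j`, and
since only one host leaf stays free, all parts together miss one vertex.

*Lower bound.* The number of cut edges is one less than the number of connected components of the
parts. Deleting all vertices whose height is congruent to `s` modulo `s + 1` leaves subtrees with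
at most `2 ^ s - 1` vertices, so every connected part of size `2 ^ s` contains one of these
vertices (`two_le_card_componentRoots`), and all other full parts have at least two components. As
there are about `2 ^ (k + 1) / (2 ^ (s + 1) - 1)` such vertices (`card_transversal`), each level
yields the explicit bound `le_cutCount`.

*Upper bound.* The root of the guest tree sits on the last leaf of the left half of the host tree,
which costs `2 * (k + 1)` for the edge to the right child and `2 * k` for the edge to the left
child. The exchange brings the root next to its left child and sends a leaf of the guest tree to
the last leaf of the left half, which saves `2` (`algCost_succ_le_of_odd`). The resulting recursion
is solved by `algCost_le`: the cost is at most `(29 / 3) * 2 ^ k - 4 * k - 9 + (-1) ^ k / 3`.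

With transversals of size about `(8 / 7) * 2 ^ (k - 2)` for `s = 2` and at most
`(16 / 15) * 2 ^ (k - s)` for `s ≥ 3`, the leading coefficients leave a factor below `203 / 200`,
and the lower order terms are compared in `algCost_le_mul_sum_cutCount`.
-/

/-! ### Binary words and distances in the complete binary tree -/

/-- The binary words of length at most `k`, that is, the vertices of the complete binary tree of
height `k`, as a finite set built along the decomposition into the root and the two basic
subtrees. -/
def words : ℕ → Finset (List Bool)
  | 0 => {[]}
  | k + 1 => insert [] ((words k).image (List.cons false) ∪ (words k).image (List.cons true))

theorem mem_words {k : ℕ} {w : List Bool} : w ∈ words k ↔ w.length ≤ k := by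
  induction k generalizing w with
  | zero => simp [words]
  | succ k ih =>
    rcases w with _ | ⟨b, w⟩
    · simp [words]
    · cases b <;> simp [words, ih]

theorem nil_mem_words (k : ℕ) : [] ∈ words k := by simp [mem_words]

theorem sum_words_succ {M : Type*} [AddCommMonoid M] (k : ℕ) (f : List Bool → M) :
    ∑ w ∈ words (k + 1), f w =
      f [] + (∑ w ∈ words k, f (false :: w) + ∑ w ∈ words k, f (true :: w)) := by
  have hdisj : Disjoint ((words k).image (List.cons false)) ((words k).image (List.cons true)) := by
    simp [Finset.disjoint_left]
  rw [words, Finset.sum_insert (by simp), Finset.sum_union hdisj,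
    Finset.sum_image (by simp), Finset.sum_image (by simp)]

theorem card_words (k : ℕ) : (words k).card + 1 = 2 ^ (k + 1) := by
  induction k with
  | zero => simp [words]
  | succ k ih =>
    have h := sum_words_succ k (fun _ => 1)
    simp only [← Finset.card_eq_sum_ones] at h
    rw [h, pow_succ]
    omega

/-- The distance of two vertices of the infinite binary tree: the sum of the lengths of the words
that remain after the longest common prefix has been removed. -/
def wordDist : List Bool → List Bool → ℕ
  | [], v => v.length
  | _ :: u, [] => u.length + 1
  | a :: u, b :: v => if a = b then wordDist u v else u.length + v.length + 2

theorem wordDist_self (u : List Bool) : wordDist u u = 0 := by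
  induction u with
  | nil => rfl
  | cons a u ih => simpa [wordDist] using ih

theorem wordDist_le (u v : List Bool) : wordDist u v ≤ u.length + v.length := by
  induction u generalizing v with
  | nil => simp [wordDist]
  | cons a u ih =>
    rcases v with _ | ⟨b, v⟩
    · simp [wordDist]
    · have := ih v
      simp only [wordDist, List.length_cons]
      split <;> omega

theorem wordDist_append_singleton (u v : List Bool) (c : Bool) :
    wordDist (u ++ [c]) v ≤ wordDist u v + 1 ∧ wordDist u v ≤ wordDist (u ++ [c]) v + 1 := by
  induction u generalizing v with
  | nil =>
    rcases v with _ | ⟨b, v⟩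
    · simp [wordDist]
    · simp only [List.nil_append, wordDist, List.length_cons, List.length_nil]
      split <;> omega
  | cons a u ih =>
    rcases v with _ | ⟨b, v⟩
    · simp [wordDist]
    · have := ih v
      simp only [List.cons_append, wordDist, List.length_append, List.length_cons, List.length_nil]
      split <;> omega

theorem exists_common_prefix (u v : List Bool) :
    ∃ p x y, u = p ++ x ∧ v = p ++ y ∧ x.length + y.length = wordDist u v := by
  induction u generalizing v with
  | nil => exact ⟨[], [], v, by simp [wordDist]⟩
  | cons a u ih =>
    rcases v with _ | ⟨b, v⟩
    · exact ⟨[], a :: u, [], by simp [wordDist]⟩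
    · by_cases hab : a = b
      · subst hab
        obtain ⟨p, x, y, rfl, rfl, h⟩ := ih v
        exact ⟨a :: p, x, y, by simp [wordDist, h]⟩
      · refine ⟨[], a :: u, b :: v, ?_⟩
        simp only [wordDist, hab, List.nil_append, List.length_cons, if_false, true_and]
        omega

theorem wordDist_le_length {h : ℕ} {u v : BTVertex h} (p : (completeBinaryTree h).Walk u v) :
    wordDist u.1 v.1 ≤ p.length := by
  induction p with
  | nil => simp [wordDist_self]
  | @cons u w v huw p ih =>
    rw [SimpleGraph.Walk.length_cons]
    rcases huw with ⟨c, hc⟩ | ⟨c, hc⟩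
    · have := (wordDist_append_singleton u.1 v.1 c).2
      rw [← hc] at this
      omega
    · have := (wordDist_append_singleton w.1 v.1 c).1
      rw [← hc] at this
      omega

theorem exists_walk_to_prefix {h : ℕ} (p x : List Bool) (hpx : (p ++ x).length ≤ h) :
    ∃ q : (completeBinaryTree h).Walk ⟨p ++ x, hpx⟩
      ⟨p, by rw [List.length_append] at hpx; omega⟩, q.length = x.length := by
  induction x using List.reverseRecOn with
  | nil => exact ⟨SimpleGraph.Walk.nil.copy (by simp) rfl, by simp⟩
  | append_singleton x c ih =>
    have hx : (p ++ x).length ≤ h := by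
      simp only [List.length_append, List.length_cons] at hpx ⊢
      omega
    obtain ⟨q, hq⟩ := ih hx
    have hadj : (completeBinaryTree h).Adj ⟨p ++ (x ++ [c]), hpx⟩ ⟨p ++ x, hx⟩ :=
      Or.inr ⟨c, by simp⟩
    exact ⟨SimpleGraph.Walk.cons hadj q, by simp [hq]⟩

theorem dist_completeBinaryTree {h : ℕ} (u v : BTVertex h) :
    (completeBinaryTree h).dist u v = wordDist u.1 v.1 := by
  obtain ⟨p, x, y, hu, hv, hxy⟩ := exists_common_prefix u.1 v.1
  obtain ⟨q, hq⟩ := exists_walk_to_prefix (h := h) p x (hu ▸ u.2)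
  obtain ⟨r, hr⟩ := exists_walk_to_prefix (h := h) p y (hv ▸ v.2)
  let t : (completeBinaryTree h).Walk u v :=
    (q.append r.reverse).copy (Subtype.ext hu.symm) (Subtype.ext hv.symm)
  have ht : t.length = wordDist u.1 v.1 := by
    simp [t, hq, hr, hxy]
  apply le_antisymm
  · exact ht ▸ SimpleGraph.dist_le t
  · obtain ⟨s, hs⟩ := SimpleGraph.Reachable.exists_walk_length_eq_dist ⟨t⟩
    exact hs ▸ wordDist_le_length s

/-! ### The objective value as a sum over the non-root vertices of the guest tree -/

/-- The cost of placing the vertices of the complete binary tree of height `k` on the words given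
by `F`: every vertex other than the root contributes the distance to the place of its parent. -/
def placementCost (k : ℕ) (F : List Bool → List Bool) : ℕ :=
  ∑ w ∈ words k, if w = [] then 0 else wordDist (F w.dropLast) (F w)

/-- The placement of the words of length at most `k` given by `φ`; the value on longer words is a
dummy. -/
def wordPlacement {k h : ℕ} (φ : BTVertex k → BTVertex h) (w : List Bool) : List Bool :=
  if hw : w.length ≤ k then (φ ⟨w, hw⟩).1 else []

theorem OV_eq_placementCost {k : ℕ} (φ : BTVertex k → BTVertex (k + 1)) :
    OV φ = placementCost k (wordPlacement φ) := by
  classical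
  have hdrop : ∀ {w : List Bool}, w ∈ (words k).filter (· ≠ []) → w.dropLast.length ≤ k := by
    intro w hw
    have := mem_words.1 (Finset.mem_filter.1 hw).1
    rw [List.length_dropLast]
    omega
  have hlen : ∀ {w : List Bool}, w ∈ (words k).filter (· ≠ []) → w.length ≤ k :=
    fun hw => mem_words.1 (Finset.mem_filter.1 hw).1
  unfold OV objectiveValue placementCost
  rw [Finset.sum_congr rfl (fun w _ => (ite_not (w = []) _ _).symm), ← Finset.sum_filter]
  symm
  refine Finset.sum_bij
    (fun w hw => s((⟨w.dropLast, hdrop hw⟩ : BTVertex k), (⟨w, hlen hw⟩ : BTVertex k))) ?_ ?_ ?_ ?_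
  · intro w hw
    have hne := (Finset.mem_filter.1 hw).2
    rw [SimpleGraph.mem_edgeFinset, SimpleGraph.mem_edgeSet]
    exact Or.inl ⟨w.getLast hne, (List.dropLast_append_getLast hne).symm⟩
  · intro v hv w hw hvw
    have hne := (Finset.mem_filter.1 hv).2
    have hne' := (Finset.mem_filter.1 hw).2
    rcases Sym2.eq_iff.1 hvw with ⟨_, h⟩ | ⟨h1, h2⟩
    · exact congrArg Subtype.val h
    · -- a word cannot be longer than its own grandchild
      have h1 := congrArg (fun x => x.1.length) h1
      have h2 := congrArg (fun x => x.1.length) h2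
      simp only [List.length_dropLast] at h1 h2
      have := List.length_pos_iff.2 hne
      have := List.length_pos_iff.2 hne'
      omega
  · intro e he
    rw [SimpleGraph.mem_edgeFinset] at he
    induction e using Sym2.ind with
    | _ u v =>
    rcases he with ⟨c, hc⟩ | ⟨c, hc⟩
    · change v.1 = u.1 ++ [c] at hc
      refine ⟨v.1, Finset.mem_filter.2 ⟨mem_words.2 v.2, by simp [hc]⟩, ?_⟩
      simp [hc, Subtype.ext_iff]
    · change u.1 = v.1 ++ [c] at hc
      refine ⟨u.1, Finset.mem_filter.2 ⟨mem_words.2 u.2, by simp [hc]⟩, ?_⟩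
      rw [Sym2.eq_swap]
      simp [hc, Subtype.ext_iff]
  · intro w hw
    have h1 := hdrop hw
    have h2 := hlen hw
    rw [wordPlacement, wordPlacement, dif_pos h1, dif_pos h2]
    exact (dist_completeBinaryTree _ _).symm

theorem placementCost_congr {k : ℕ} {F F' : List Bool → List Bool}
    (hF : ∀ w ∈ words k, F w = F' w) : placementCost k F = placementCost k F' := by
  refine Finset.sum_congr rfl fun w hw => ?_
  have hd : w.dropLast ∈ words k := by
    rw [mem_words] at hw ⊢
    rw [List.length_dropLast]
    omega
  rw [hF w hw, hF _ hd]

theorem placementCost_succ (k : ℕ) (F : List Bool → List Bool) :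
    placementCost (k + 1) F = wordDist (F []) (F [false]) + wordDist (F []) (F [true]) +
      placementCost k (fun w => F (false :: w)) + placementCost k (fun w => F (true :: w)) := by
  have key : ∀ b : Bool, ∑ w ∈ words k, wordDist (F (b :: w).dropLast) (F (b :: w)) =
      wordDist (F []) (F [b]) + placementCost k (fun w => F (b :: w)) := by
    intro b
    unfold placementCost
    rw [← Finset.add_sum_erase _ _ (nil_mem_words k), ← Finset.add_sum_erase _ _ (nil_mem_words k)]
    simp only [List.dropLast_singleton, if_true, zero_add]
    congr 1
    refine Finset.sum_congr rfl fun w hw => ?_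
    have hne := Finset.ne_of_mem_erase hw
    rw [if_neg hne, List.dropLast_cons_of_ne_nil hne]
  have h := sum_words_succ k (fun w => if w = [] then 0 else wordDist (F w.dropLast) (F w))
  simp only [if_true, reduceCtorEq, if_false, zero_add, key] at h
  rw [placementCost, h]
  omega

/-- Moving a leaf of the guest tree changes only the contribution of the edge to its parent. -/
theorem placementCost_update_leaf {k : ℕ} (F : List Bool → List Bool) {r : List Bool}
    (hr : r.length = k) (hne : r ≠ []) (x : List Bool) :
    placementCost k (Function.update F r x) + wordDist (F r.dropLast) (F r) =
      placementCost k F + wordDist (F r.dropLast) x := by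
  have hpos := List.length_pos_iff.2 hne
  have hmem : r ∈ words k := mem_words.2 hr.le
  have hdrop : ∀ w ∈ words k, w ≠ [] → w.dropLast ≠ r := by
    intro w hw hw0 h
    have h1 := congrArg List.length h
    have h2 := mem_words.1 hw
    have h3 := List.length_pos_iff.2 hw0
    rw [List.length_dropLast] at h1
    omega
  unfold placementCost
  rw [← Finset.add_sum_erase _ _ hmem, ← Finset.add_sum_erase _ _ hmem]
  rw [if_neg hne, if_neg hne, Function.update_self, Function.update_of_ne (hdrop r hmem hne)]
  have hrest : ∑ w ∈ (words k).erase r, (if w = [] then 0 else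
        wordDist (Function.update F r x w.dropLast) (Function.update F r x w)) =
      ∑ w ∈ (words k).erase r, if w = [] then 0 else wordDist (F w.dropLast) (F w) := by
    refine Finset.sum_congr rfl fun w hw => ?_
    split
    · rfl
    · rename_i hw0
      rw [Function.update_of_ne (Finset.ne_of_mem_erase hw),
        Function.update_of_ne (hdrop w (Finset.mem_of_mem_erase hw) hw0)]
  rw [hrest]
  omega

/-! ### Cuts -/

/-- The distance of two leaves is twice the number of levels on which their ancestors differ. -/
theorem wordDist_eq_sum {h : ℕ} {x y : List Bool} (hx : x.length = h) (hy : y.length = h) :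
    wordDist x y = 2 * ∑ j ∈ Finset.range h, if x.take (j + 1) ≠ y.take (j + 1) then 1 else 0 := by
  induction h generalizing x y with
  | zero =>
    rw [List.length_eq_zero_iff.1 hx, List.length_eq_zero_iff.1 hy]
    rfl
  | succ h ih =>
    rcases x with _ | ⟨a, x⟩
    · simp at hx
    rcases y with _ | ⟨b, y⟩
    · simp at hy
    simp only [List.length_cons, add_left_inj] at hx hy
    rw [Finset.sum_range_succ']
    by_cases hab : a = b
    · subst hab
      simp [wordDist, ih hx hy]
    · simp only [wordDist, hab, if_false, List.take_succ_cons, ne_eq, List.cons.injEq, false_and,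
        not_false_eq_true, if_true, Finset.sum_const, Finset.card_range, smul_eq_mul, hx, hy]
      omega

/-- The number of guest edges that are cut when the host leaves are partitioned by their ancestors
of level `j`. -/
def cutCount (k : ℕ) (F : List Bool → List Bool) (j : ℕ) : ℕ :=
  ((words k).filter fun w => w ≠ [] ∧ (F w.dropLast).take j ≠ (F w).take j).card

theorem placementCost_eq_sum_cutCount {k h : ℕ} {F : List Bool → List Bool}
    (hF : ∀ w ∈ words k, (F w).length = h) :
    placementCost k F = 2 * ∑ j ∈ Finset.range h, cutCount k F (j + 1) := by
  simp only [cutCount, Finset.card_filter]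
  rw [Finset.sum_comm, Finset.mul_sum]
  refine Finset.sum_congr rfl fun w hw => ?_
  have hd : w.dropLast ∈ words k := by
    rw [mem_words] at hw ⊢
    rw [List.length_dropLast]
    omega
  by_cases hne : w = []
  · simp [hne]
  · rw [if_neg hne, wordDist_eq_sum (hF _ hd) (hF _ hw)]
    simp [hne]

/-! ### A transversal of the connected vertex sets with `2 ^ s` elements -/

/-- The vertices of the complete binary tree of height `k` whose height above the leaves is
congruent to `s` modulo `s + 1`. Deleting them leaves subtrees with at most `2 ^ s - 1` vertices. -/
def transversal (k s : ℕ) : Finset (List Bool) :=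
  (words k).filter fun w => (k - w.length) % (s + 1) = s

theorem card_transversal_succ (k s : ℕ) :
    (transversal (k + 1) s).card =
      (if (k + 1) % (s + 1) = s then 1 else 0) + 2 * (transversal k s).card := by
  simp only [transversal, Finset.card_filter, sum_words_succ, List.length_nil, List.length_cons,
    Nat.add_sub_add_right, Nat.sub_zero]
  omega

/-- The transversal has about `2 ^ (k + 1) / (2 ^ (s + 1) - 1)` elements; the identity avoids
division and subtraction. -/
theorem card_transversal (k s : ℕ) :
    (transversal k s).card * 2 ^ (s + 1) + 2 ^ ((k + 1) % (s + 1)) =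
      2 ^ (k + 1) + (transversal k s).card := by
  induction k with
  | zero =>
    rcases s with _ | s
    · simp [transversal, words]
    · simp [transversal]
  | succ k ih =>
    have hmod : (k + 1 + 1) % (s + 1) =
        if (k + 1) % (s + 1) = s then 0 else (k + 1) % (s + 1) + 1 := by
      have hlt : (k + 1) % (s + 1) < s + 1 := Nat.mod_lt _ (Nat.succ_pos s)
      conv_lhs => rw [← Nat.div_add_mod (k + 1) (s + 1), add_assoc, Nat.mul_add_mod]
      split
      · rename_i h
        rw [h, Nat.mod_self]
      · exact Nat.mod_eq_of_lt (by omega)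
    rw [card_transversal_succ, hmod, pow_succ 2 (k + 1)]
    generalize (k + 1) % (s + 1) = r at *
    by_cases hr : r = s
    · subst hr
      rw [if_pos rfl, if_pos rfl]
      rw [pow_succ] at ih ⊢
      nlinarith
    · rw [if_neg hr, if_neg hr, pow_succ 2 r]
      nlinarith

/-- The roots of the connected components of a set `P` of vertices: the elements of `P` whose
parent does not exist or is not in `P`. -/
def componentRoots (P : Finset (List Bool)) : Finset (List Bool) :=
  P.filter fun w => w = [] ∨ w.dropLast ∉ P

theorem componentRoots_nonempty {P : Finset (List Bool)} (hP : P.Nonempty) :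
    (componentRoots P).Nonempty := by
  obtain ⟨r, hr, hmin⟩ := Finset.exists_min_image P List.length hP
  refine ⟨r, Finset.mem_filter.2 ⟨hr, ?_⟩⟩
  by_contra! h
  have h1 := hmin _ h.2
  have h2 := List.length_pos_iff.2 h.1
  rw [List.length_dropLast] at h1
  omega

/-- A set of at least `2 ^ s` vertices that avoids the transversal is not connected: below the
root of a component all vertices stay within one block of `s` levels between consecutive levels
of the transversal, where a component has room for at most `2 ^ s - 1` vertices. -/
theorem two_le_card_componentRoots {k s : ℕ} {P : Finset (List Bool)} (hP : P ⊆ words k)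
    (hS : ∀ w ∈ P, (k - w.length) % (s + 1) ≠ s) (hcard : 2 ^ s ≤ P.card) :
    2 ≤ (componentRoots P).card := by
  have hne : P.Nonempty := Finset.card_pos.1 (lt_of_lt_of_le (by positivity) hcard)
  obtain ⟨r, hr⟩ := componentRoots_nonempty hne
  by_contra! hlt
  have huniq : ∀ w ∈ componentRoots P, w = r := fun w hw =>
    Finset.card_le_one.1 (by omega) w hw r hr
  have hrP : r ∈ P := (Finset.mem_filter.1 hr).1
  have claim : ∀ w, w ∈ P →
      (∃ x, w = r ++ x) ∧ (k - w.length) / (s + 1) = (k - r.length) / (s + 1) := by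
    intro w
    induction w using List.reverseRecOn with
    | nil =>
      intro hw
      have := huniq [] (Finset.mem_filter.2 ⟨hw, Or.inl rfl⟩)
      subst this
      exact ⟨⟨[], rfl⟩, rfl⟩
    | append_singleton w c ih =>
      intro hw
      by_cases hpar : w ∈ P
      · obtain ⟨⟨x, hx⟩, hdiv⟩ := ih hpar
        refine ⟨⟨x ++ [c], by rw [hx, List.append_assoc]⟩, ?_⟩
        have hlen := mem_words.1 (hP hw)
        have hmod := hS _ hw
        rw [List.length_append, List.length_singleton] at hlen hmod ⊢
        obtain ⟨t, ht⟩ : ∃ t, t = k - (w.length + 1) := ⟨_, rfl⟩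
        have ht' : k - w.length = t + 1 := by omega
        rw [← ht] at hmod ⊢
        rw [← hdiv, ht', Nat.succ_div, if_neg, add_zero]
        rintro ⟨q, hq⟩
        apply hmod
        obtain ⟨q, rfl⟩ : ∃ q', q = q' + 1 := ⟨q - 1, by rcases q with _ | q <;> simp at hq ⊢⟩
        have : t = (s + 1) * q + s := by rw [mul_add] at hq; omega
        rw [this, Nat.mul_add_mod, Nat.mod_eq_of_lt (by omega)]
      · have := huniq (w ++ [c]) (Finset.mem_filter.2 ⟨hw, Or.inr (by simpa using hpar)⟩)
        rw [this]
        exact ⟨⟨[], by simp⟩, rfl⟩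
  rcases s with _ | s
  · exact hS r hrP (by simp [Nat.mod_one])
  have hsub : P ⊆ (words s).image (r ++ ·) := by
    intro w hw
    obtain ⟨⟨x, rfl⟩, hdiv⟩ := claim w hw
    refine Finset.mem_image.2 ⟨x, mem_words.2 ?_, rfl⟩
    have hlen := mem_words.1 (hP hw)
    have h1 := Nat.div_add_mod (k - r.length) (s + 1 + 1)
    have h2 := Nat.div_add_mod (k - (r ++ x).length) (s + 1 + 1)
    have h3 : (k - r.length) % (s + 1 + 1) < s + 1 + 1 := Nat.mod_lt _ (Nat.succ_pos _)
    have h4 := hS r hrP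
    rw [hdiv] at h2
    rw [List.length_append] at hlen h2
    generalize (s + 1 + 1) * ((k - r.length) / (s + 1 + 1)) = q at h1 h2
    omega
  have h1 := Finset.card_le_card hsub
  have h2 : ((words s).image (r ++ ·)).card ≤ (words s).card := Finset.card_image_le
  have h3 := card_words s
  omega

/-- A part of a partition into parts of size at most `2 ^ s` splits into two components unless it
meets the transversal or falls short of full size; each missing vertex is charged `1`. -/
theorem two_add_card_le {k s : ℕ} (hs : 1 ≤ s) {P : Finset (List Bool)} (hP : P ⊆ words k)
    (hcard : P.card ≤ 2 ^ s) :
    2 + P.card ≤ (componentRoots P).card +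
      (P.filter fun w => (k - w.length) % (s + 1) = s).card + 2 ^ s := by
  have h2 : 2 ≤ 2 ^ s := by
    calc 2 = 2 ^ 1 := rfl
      _ ≤ 2 ^ s := Nat.pow_le_pow_right (by norm_num) hs
  rcases P.eq_empty_or_nonempty with rfl | hne
  · rw [Finset.card_empty]
    omega
  have h1 := (componentRoots_nonempty hne).card_pos
  by_cases hfull : P.card = 2 ^ s
  · by_cases hS : ∀ w ∈ P, (k - w.length) % (s + 1) ≠ s
    · have := two_le_card_componentRoots hP hS hfull.ge
      omega
    · push Not at hS
      obtain ⟨w, hw, hws⟩ := hS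
      have : 0 < (P.filter fun w => (k - w.length) % (s + 1) = s).card :=
        Finset.card_pos.2 ⟨w, Finset.mem_filter.2 ⟨hw, hws⟩⟩
      omega
  · omega

/-! ### The lower bound for an arbitrary arrangement -/

theorem card_filter_words_length (j : ℕ) :
    ((words j).filter fun w => w.length = j).card = 2 ^ j := by
  induction j with
  | zero => rfl
  | succ j ih =>
    rw [Finset.card_filter] at ih ⊢
    rw [sum_words_succ, pow_succ]
    simp only [List.length_nil, List.length_cons, add_left_inj, ih, Nat.right_eq_add,
      Nat.add_eq_zero_iff, one_ne_zero, and_false, if_false]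
    omega

/-- Partitioning the guest tree into `2 ^ j` parts of size at most `2 ^ s` cuts at least
`2 * 2 ^ j - 2` edges less the size of the transversal. The number of cut edges is one less than
the number of components of the parts, and `two_add_card_le` is summed over the parts, which
miss a single vertex altogether. -/
theorem le_cutCount {k j s : ℕ} (hs : 1 ≤ s) (hjs : j + s = k + 1) {F : List Bool → List Bool}
    (hF : ∀ w ∈ words k, (F w).length = k + 1)
    (hinj : ∀ v ∈ words k, ∀ w ∈ words k, F v = F w → v = w) :
    2 * 2 ^ j ≤ cutCount k F j + 2 + (transversal k s).card := by
  let Q : Finset (List Bool) := (words j).filter fun w => w.length = j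
  let P : List Bool → Finset (List Bool) := fun p => (words k).filter fun w => (F w).take j = p
  have hQ : ∀ w ∈ words k, (F w).take j ∈ Q := by
    intro w hw
    have : ((F w).take j).length = j := by rw [List.length_take, hF w hw]; omega
    exact Finset.mem_filter.2 ⟨mem_words.2 this.le, this⟩
  have hPcard : ∀ p, (P p).card ≤ 2 ^ s := by
    intro p
    rw [← card_filter_words_length s]
    refine Finset.card_le_card_of_injOn (fun w => (F w).drop j) ?_ ?_
    · intro w hw
      have hw := (Finset.mem_filter.1 hw).1
      have : ((F w).drop j).length = s := by rw [List.length_drop, hF w hw]; omega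
      exact Finset.mem_coe.2 (Finset.mem_filter.2 ⟨mem_words.2 this.le, this⟩)
    · intro v hv w hw hvw
      have hv := Finset.mem_filter.1 (Finset.mem_coe.1 hv)
      have hw := Finset.mem_filter.1 (Finset.mem_coe.1 hw)
      apply hinj v hv.1 w hw.1
      rw [← List.take_append_drop j (F v), ← List.take_append_drop j (F w), hv.2, hw.2]
      exact congrArg (p ++ ·) hvw
  have hsum := Finset.sum_le_sum fun p (_ : p ∈ Q) =>
    two_add_card_le (k := k) hs (P := P p) (Finset.filter_subset _ _) (hPcard p)
  simp only [Finset.sum_add_distrib, Finset.sum_const, smul_eq_mul] at hsum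
  rw [show Q.card = 2 ^ j from card_filter_words_length j] at hsum
  have h1 : ∑ p ∈ Q, (P p).card = (words k).card :=
    (Finset.card_eq_sum_card_fiberwise hQ).symm
  have h2 : ∑ p ∈ Q, ((P p).filter fun w => (k - w.length) % (s + 1) = s).card =
      (transversal k s).card := by
    rw [Finset.card_eq_sum_card_fiberwise (s := transversal k s) (t := Q)
      (f := fun w => (F w).take j) (fun w hw => hQ w (Finset.mem_filter.1 hw).1)]
    refine Finset.sum_congr rfl fun p _ => ?_
    simp only [P, transversal, Finset.filter_comm]
  let U : Finset (List Bool) :=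
    (words k).filter fun w => w = [] ∨ (F w.dropLast).take j ≠ (F w).take j
  have h3 : ∑ p ∈ Q, (componentRoots (P p)).card = U.card := by
    rw [Finset.card_eq_sum_card_fiberwise (s := U) (t := Q)
      (f := fun w => (F w).take j) (fun w hw => hQ w (Finset.mem_filter.1 hw).1)]
    refine Finset.sum_congr rfl fun p _ => congrArg Finset.card ?_
    ext w
    have hd : w ∈ words k → w.dropLast ∈ words k := by
      intro hw
      rw [mem_words] at hw ⊢
      rw [List.length_dropLast]
      omega
    simp only [componentRoots, P, U, Finset.mem_filter, not_and]
    constructor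
    · rintro ⟨⟨hw, rfl⟩, h⟩
      exact ⟨⟨hw, h.imp_right fun h => h (hd hw)⟩, rfl⟩
    · rintro ⟨⟨hw, h⟩, rfl⟩
      exact ⟨⟨hw, rfl⟩, h.imp_right fun h _ => h⟩
  have h4 : U.card ≤ cutCount k F j + 1 := by
    refine le_trans (Finset.card_le_card ?_) (Finset.card_insert_le [] _)
    intro w hw
    have hw := Finset.mem_filter.1 hw
    by_cases hne : w = []
    · exact Finset.mem_insert.2 (Or.inl hne)
    · exact Finset.mem_insert_of_mem (Finset.mem_filter.2 ⟨hw.1, hne, hw.2.resolve_left hne⟩)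
  have h5 := card_words k
  have h6 : 2 ^ j * 2 ^ s = 2 ^ (k + 1) := by rw [← pow_add, hjs]
  rw [h1, h2, h3] at hsum
  omega

/-- On the lowest level every part is a single leaf, so all edges are cut. -/
theorem cutCount_full {k : ℕ} {F : List Bool → List Bool}
    (hF : ∀ w ∈ words k, (F w).length = k + 1)
    (hinj : ∀ v ∈ words k, ∀ w ∈ words k, F v = F w → v = w) :
    cutCount k F (k + 1) + 2 = 2 ^ (k + 1) := by
  have h : ((words k).filter fun w => w ≠ [] ∧ (F w.dropLast).take (k + 1) ≠ (F w).take (k + 1)) =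
      (words k).erase [] := by
    ext w
    simp only [Finset.mem_filter, Finset.mem_erase]
    refine ⟨fun h => ⟨h.2.1, h.1⟩, fun h => ⟨h.2, h.1, fun he => ?_⟩⟩
    have hd : w.dropLast ∈ words k := by
      have := mem_words.1 h.2
      rw [mem_words, List.length_dropLast]
      omega
    rw [List.take_of_length_le (hF _ hd).le, List.take_of_length_le (hF _ h.2).le] at he
    have h1 := congrArg List.length (hinj _ hd _ h.2 he)
    have h2 := List.length_pos_iff.2 h.1
    rw [List.length_dropLast] at h1
    omega
  rw [cutCount, h, Finset.card_erase_of_mem (nil_mem_words k)]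
  have h1 := card_words k
  have h2 := Finset.card_pos.2 ⟨_, nil_mem_words k⟩
  omega

/-! ### The arrangement computed by the algorithm -/

theorem leafWord_of_le {h i : ℕ} (hi : i ≤ 2 ^ h) :
    leafWord (h + 1) i = false :: leafWord h i := if_pos hi

theorem leafWord_add {h i : ℕ} (hi : 1 ≤ i) :
    leafWord (h + 1) (2 ^ h + i) = true :: leafWord h i := by
  rw [leafWord, if_neg (by omega), Nat.add_sub_cancel_left]

theorem leafWord_injOn {h i j : ℕ} (hi : 1 ≤ i) (hi' : i ≤ 2 ^ h) (hj : 1 ≤ j) (hj' : j ≤ 2 ^ h)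
    (hij : leafWord h i = leafWord h j) : i = j := by
  induction h generalizing i j with
  | zero => simp at hi' hj'; omega
  | succ h ih =>
    rw [pow_succ] at hi' hj'
    unfold leafWord at hij
    split at hij <;> split at hij
    · exact ih hi (by assumption) hj (by assumption) (List.cons.inj hij).2
    · simp at hij
    · simp at hij
    · have := ih (i := i - 2 ^ h) (j := j - 2 ^ h) (by omega) (by omega) (by omega) (by omega)
        (List.cons.inj hij).2
      omega

theorem wordDist_leafWord_le (h i j : ℕ) : wordDist (leafWord h i) (leafWord h j) ≤ 2 * h := by
  have := wordDist_le (leafWord h i) (leafWord h j)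
  rw [length_leafWord, length_leafWord] at this
  omega

/-- The last two leaves are siblings. -/
theorem wordDist_leafWord_last_two (m : ℕ) :
    wordDist (leafWord (m + 1) (2 ^ (m + 1) - 1)) (leafWord (m + 1) (2 ^ (m + 1))) = 2 := by
  induction m with
  | zero => simp [leafWord, wordDist]
  | succ m ih =>
    have h2 : 2 ≤ 2 ^ (m + 1) := by rw [pow_succ]; have := Nat.one_le_two_pow (n := m); omega
    have e1 : 2 ^ (m + 1 + 1) - 1 = 2 ^ (m + 1) + (2 ^ (m + 1) - 1) := by rw [pow_succ]; omega
    have e2 : 2 ^ (m + 1 + 1) = 2 ^ (m + 1) + 2 ^ (m + 1) := by rw [pow_succ]; omega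
    rw [e1, e2, leafWord_add (by omega), leafWord_add (by omega)]
    simpa [wordDist] using ih

/-- The third last and the second last leaf lie in different halves of the last four leaves. -/
theorem wordDist_leafWord_second_third_last (m : ℕ) :
    wordDist (leafWord (m + 2) (2 ^ (m + 2) - 2)) (leafWord (m + 2) (2 ^ (m + 2) - 1)) = 4 := by
  induction m with
  | zero => simp [leafWord, wordDist]
  | succ m ih =>
    have h2 : 4 ≤ 2 ^ (m + 2) := by
      rw [pow_succ, pow_succ]; have := Nat.one_le_two_pow (n := m); omega
    have e1 : 2 ^ (m + 1 + 2) - 2 = 2 ^ (m + 2) + (2 ^ (m + 2) - 2) := by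
      rw [show m + 1 + 2 = m + 2 + 1 by ring, pow_succ]; omega
    have e2 : 2 ^ (m + 1 + 2) - 1 = 2 ^ (m + 2) + (2 ^ (m + 2) - 1) := by
      rw [show m + 1 + 2 = m + 2 + 1 by ring, pow_succ]; omega
    rw [e1, e2, show m + 1 + 2 = m + 2 + 1 by ring, leafWord_add (by omega),
      leafWord_add (by omega)]
    simpa [wordDist] using ih

/-- The index given to a vertex by one step of the recursion before the final exchange. -/
def mergedIndex (k : ℕ) : List Bool → ℕ
  | [] => 2 ^ (k + 1)
  | false :: w => algorithmA k w
  | true :: w => 2 ^ (k + 1) + algorithmA k w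

theorem algorithmA_succ (k : ℕ) (w : List Bool) : algorithmA (k + 1) w =
    if Odd (k + 1) ∧ 3 ≤ k + 1 then Equiv.swap (2 ^ k - 1) (2 ^ (k + 1)) (mergedIndex k w)
    else mergedIndex k w := by
  have e1 : 2 ^ (k + 2) / 2 = 2 ^ (k + 1) := by rw [pow_succ]; omega
  have e2 : 2 ^ (k + 2) / 4 = 2 ^ k := by rw [pow_succ, pow_succ]; omega
  rcases w with _ | ⟨_ | _, w⟩ <;> simp only [algorithmA, mergedIndex, e1, e2]

theorem algorithmA_of_not {k : ℕ} (hk : ¬(Odd (k + 1) ∧ 3 ≤ k + 1)) (w : List Bool) :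
    algorithmA (k + 1) w = mergedIndex k w := by
  rw [algorithmA_succ, if_neg hk]

theorem algorithmA_of_odd {k : ℕ} (hk : Odd (k + 1)) (hk' : 3 ≤ k + 1) (w : List Bool) :
    algorithmA (k + 1) w = Equiv.swap (2 ^ k - 1) (2 ^ (k + 1)) (mergedIndex k w) := by
  rw [algorithmA_succ, if_pos ⟨hk, hk'⟩]

/-- The algorithm never uses the last leaf. -/
theorem algorithmA_bounds (k : ℕ) (w : List Bool) :
    1 ≤ algorithmA k w ∧ algorithmA k w + 1 ≤ 2 ^ (k + 1) := by
  induction k generalizing w with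
  | zero => simp [algorithmA]
  | succ k ih =>
    have h1 : 2 ≤ 2 ^ (k + 1) := by rw [pow_succ]; have := Nat.one_le_two_pow (n := k); omega
    have hm : 1 ≤ mergedIndex k w ∧ mergedIndex k w + 1 ≤ 2 ^ (k + 1 + 1) := by
      rw [pow_succ]
      rcases w with _ | ⟨_ | _, w⟩
      · simp only [mergedIndex]; omega
      · have := ih w; simp only [mergedIndex]; omega
      · have := ih w; simp only [mergedIndex]; omega
    by_cases hk : Odd (k + 1) ∧ 3 ≤ k + 1
    · rw [algorithmA_of_odd hk.1 hk.2, Equiv.swap_apply_def]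
      have h2 : 2 ≤ 2 ^ k := by
        calc 2 = 2 ^ 1 := rfl
          _ ≤ 2 ^ k := Nat.pow_le_pow_right (by norm_num) (by omega)
      have h3 : 2 ^ (k + 1 + 1) = 2 * 2 ^ (k + 1) := by rw [pow_succ]; ring
      have h4 : 2 ^ (k + 1) = 2 * 2 ^ k := by rw [pow_succ]; ring
      split_ifs <;> omega
    · rwa [algorithmA_of_not hk]

theorem algorithmA_injOn (k : ℕ) {v w : List Bool} (hv : v.length ≤ k) (hw : w.length ≤ k)
    (hvw : algorithmA k v = algorithmA k w) : v = w := by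
  induction k generalizing v w with
  | zero =>
    rw [List.length_eq_zero_iff.1 (Nat.le_zero.1 hv), List.length_eq_zero_iff.1 (Nat.le_zero.1 hw)]
  | succ k ih =>
    have hm : mergedIndex k v = mergedIndex k w := by
      by_cases hk : Odd (k + 1) ∧ 3 ≤ k + 1
      · rw [algorithmA_of_odd hk.1 hk.2, algorithmA_of_odd hk.1 hk.2] at hvw
        exact (Equiv.swap _ _).injective hvw
      · rwa [algorithmA_of_not hk, algorithmA_of_not hk] at hvw
    rcases v with _ | ⟨a, v⟩ <;> rcases w with _ | ⟨b, w⟩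
    · rfl
    · have := algorithmA_bounds k w
      cases b <;> simp only [mergedIndex] at hm <;> omega
    · have := algorithmA_bounds k v
      cases a <;> simp only [mergedIndex] at hm <;> omega
    · have h1 := algorithmA_bounds k v
      have h2 := algorithmA_bounds k w
      simp only [List.length_cons, add_le_add_iff_right] at hv hw
      cases a <;> cases b <;> simp only [mergedIndex] at hm
      · rw [ih hv hw hm]
      · omega
      · omega
      · rw [ih hv hw (by omega)]

theorem isArrangement_phiA (k : ℕ) : IsArrangement (phiA k) := by
  refine ⟨fun v w h => ?_, fun v => length_leafWord _ _⟩
  have hv := algorithmA_bounds k v.1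
  have hw := algorithmA_bounds k w.1
  have h := leafWord_injOn hv.1 (by omega) hw.1 (by omega) (congrArg Subtype.val h)
  exact Subtype.ext (algorithmA_injOn k v.2 w.2 h)

/-- The word of the leaf on which the algorithm puts the vertex `w`. -/
def algWord (k : ℕ) (w : List Bool) : List Bool := leafWord (k + 1) (algorithmA k w)

/-- The cost of the arrangement computed by the algorithm. -/
def algCost (k : ℕ) : ℕ := placementCost k (algWord k)

theorem OV_phiA (k : ℕ) : OV (phiA k) = algCost k := by
  rw [OV_eq_placementCost]
  exact placementCost_congr fun w hw => dif_pos (mem_words.1 hw)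

theorem wordDist_le_of_length {h : ℕ} {x y : List Bool} (hx : x.length = h) (hy : y.length = h) :
    wordDist x y ≤ 2 * h := by
  have := wordDist_le x y
  omega

/-- Without an exchange, the edge from the root to the right child joins the two halves of the
host tree, and the edge to the left child stays within the left half. -/
theorem algCost_succ_le_of_not {k : ℕ} (hk : ¬(Odd (k + 1) ∧ 3 ≤ k + 1)) :
    algCost (k + 1) ≤ 2 * algCost k + 4 * k + 6 := by
  have hnil : algWord (k + 1) [] = false :: leafWord (k + 1) (2 ^ (k + 1)) := by
    rw [algWord, algorithmA_of_not hk, mergedIndex, leafWord_of_le le_rfl]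
  have hfalse : ∀ w, algWord (k + 1) (false :: w) = false :: algWord k w := fun w => by
    have := algorithmA_bounds k w
    rw [algWord, algorithmA_of_not hk, mergedIndex, leafWord_of_le (by omega), algWord]
  have htrue : ∀ w, algWord (k + 1) (true :: w) = true :: algWord k w := fun w => by
    rw [algWord, algorithmA_of_not hk, mergedIndex, leafWord_add (algorithmA_bounds k w).1, algWord]
  have hcons : ∀ b, placementCost k (fun w => b :: algWord k w) = algCost k := fun b => by
    simp [algCost, placementCost, wordDist]
  rw [algCost, placementCost_succ]
  simp only [hnil, hfalse, htrue, hcons]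
  have h1 : wordDist (false :: leafWord (k + 1) (2 ^ (k + 1))) (false :: algWord k []) ≤
      2 * (k + 1) := by
    simpa [wordDist, algWord] using wordDist_leafWord_le (k + 1) (2 ^ (k + 1)) (algorithmA k [])
  have h2 := wordDist_le_of_length (h := k + 2)
    (x := false :: leafWord (k + 1) (2 ^ (k + 1))) (y := true :: algWord k [])
    (by simp [length_leafWord]) (by simp [algWord, length_leafWord])
  omega

/-- The rightmost leaf of the guest tree and its parent are never touched by an exchange. -/
theorem algorithmA_replicate (m : ℕ) :
    algorithmA (m + 1) (List.replicate m true) = 2 ^ (m + 2) - 2 ∧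
      algorithmA (m + 1) (List.replicate (m + 1) true) = 2 ^ (m + 2) - 1 := by
  induction m with
  | zero => simp [algorithmA]
  | succ m ih =>
    have h1 : 2 ^ (m + 1) = 2 * 2 ^ m := by rw [pow_succ]; ring
    have h2 : 2 ^ (m + 2) = 4 * 2 ^ m := by rw [pow_succ, pow_succ]; ring
    have h3 : 2 ^ (m + 1 + 2) = 8 * 2 ^ m := by rw [pow_succ, pow_succ, pow_succ]; ring
    have h4 := Nat.one_le_two_pow (n := m)
    have e1 : mergedIndex (m + 1) (List.replicate (m + 1) true) = 2 ^ (m + 1 + 2) - 2 := by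
      rw [List.replicate_succ, mergedIndex, ih.1]; omega
    have e2 : mergedIndex (m + 1) (List.replicate (m + 1 + 1) true) = 2 ^ (m + 1 + 2) - 1 := by
      rw [List.replicate_succ, mergedIndex, ih.2]; omega
    by_cases hk : Odd (m + 1 + 1) ∧ 3 ≤ m + 1 + 1
    · rw [algorithmA_of_odd hk.1 hk.2, algorithmA_of_odd hk.1 hk.2, e1, e2,
        Equiv.swap_apply_of_ne_of_ne (by omega) (by omega),
        Equiv.swap_apply_of_ne_of_ne (by omega) (by omega)]
      exact ⟨rfl, rfl⟩
    · rw [algorithmA_of_not hk, algorithmA_of_not hk]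
      exact ⟨e1, e2⟩

/-- The exchange moves the root next to its left child, at the expense of the rightmost leaf of
the left basic subtree of the left basic subtree. It saves `2` in total. -/
theorem algCost_succ_le_of_odd {k : ℕ} (hk : Odd (k + 1)) (hk' : 3 ≤ k + 1) :
    algCost (k + 1) ≤ 2 * algCost k + 4 * k + 4 := by
  obtain ⟨m, rfl⟩ : ∃ m, k = m + 2 := ⟨k - 2, by omega⟩
  have hnot : ¬(Odd (m + 1 + 1) ∧ 3 ≤ m + 1 + 1) := by
    rintro ⟨h, -⟩
    rw [Nat.odd_iff] at h hk
    omega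
  have p1 : 2 ^ (m + 1) = 2 * 2 ^ m := by rw [pow_succ]; ring
  have p2 : 2 ^ (m + 2) = 4 * 2 ^ m := by rw [pow_succ, pow_succ]; ring
  have p3 : 2 ^ (m + 3) = 8 * 2 ^ m := by rw [pow_succ, p2]; ring
  have p0 := Nat.one_le_two_pow (n := m)
  let r : List Bool := false :: List.replicate (m + 1) true
  have hrdrop : r.dropLast = false :: List.replicate m true := by
    simp only [r]
    rw [List.replicate_succ', ← List.cons_append, List.dropLast_concat]
  have hrlen : r.length = m + 2 := by simp [r]
  have hr : algorithmA (m + 2) r = 2 ^ (m + 2) - 1 := by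
    rw [algorithmA_of_not hnot, mergedIndex, (algorithmA_replicate m).2]
  have hpar : algorithmA (m + 2) r.dropLast = 2 ^ (m + 2) - 2 := by
    rw [hrdrop, algorithmA_of_not hnot, mergedIndex, (algorithmA_replicate m).1]
  have hroot : algorithmA (m + 2) [] = 2 ^ (m + 2) := by
    rw [algorithmA_of_not hnot, mergedIndex]
  have hne : ([] : List Bool) ≠ r := by simp [r]
  let x : List Bool := leafWord (m + 3) (2 ^ (m + 3))
  have hnil : algWord (m + 3) [] = false :: leafWord (m + 3) (2 ^ (m + 2) - 1) := by
    rw [algWord, algorithmA_of_odd hk hk', mergedIndex, Equiv.swap_apply_right,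
      leafWord_of_le (by omega)]
  have hfalse : ∀ w ∈ words (m + 2), algWord (m + 3) (false :: w) =
      false :: Function.update (algWord (m + 2)) r x w := by
    intro w hw
    have hb := algorithmA_bounds (m + 2) w
    rw [algWord, algorithmA_of_odd hk hk', mergedIndex]
    by_cases hwr : w = r
    · subst hwr
      rw [hr, Equiv.swap_apply_left, Function.update_self, leafWord_of_le le_rfl]
    · have : algorithmA (m + 2) w ≠ 2 ^ (m + 2) - 1 := fun h =>
        hwr (algorithmA_injOn _ (mem_words.1 hw) hrlen.le (h.trans hr.symm))
      rw [Function.update_of_ne hwr, Equiv.swap_apply_of_ne_of_ne this (by omega),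
        leafWord_of_le (by omega), algWord]
  have htrue : ∀ w, algWord (m + 3) (true :: w) = true :: algWord (m + 2) w := fun w => by
    have hb := algorithmA_bounds (m + 2) w
    rw [algWord, algorithmA_of_odd hk hk', mergedIndex,
      Equiv.swap_apply_of_ne_of_ne (by omega) (by omega), leafWord_add hb.1, algWord]
  have hcons : ∀ b F, placementCost (m + 2) (fun w => b :: F w) = placementCost (m + 2) F := by
    intro b F
    simp [placementCost, wordDist]
  rw [algCost, placementCost_succ, placementCost_congr hfalse, hcons, hnil,
    hfalse [] (nil_mem_words _), Function.update_of_ne hne]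
  simp only [htrue, hcons]
  have hupd := placementCost_update_leaf (algWord (m + 2)) hrlen hne.symm x
  have hold : wordDist (algWord (m + 2) r.dropLast) (algWord (m + 2) r) = 4 := by
    rw [algWord, algWord, hpar, hr, leafWord_of_le (h := m + 2) (i := 2 ^ (m + 2) - 2) (by omega),
      leafWord_of_le (h := m + 2) (i := 2 ^ (m + 2) - 1) (by omega)]
    simpa [wordDist] using wordDist_leafWord_second_third_last m
  have hnew : wordDist (algWord (m + 2) r.dropLast) x ≤ 2 * (m + 3) :=
    wordDist_leafWord_le _ _ _
  have hleft : wordDist (false :: leafWord (m + 3) (2 ^ (m + 2) - 1))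
      (false :: algWord (m + 2) []) = 2 := by
    rw [algWord, hroot, leafWord_of_le (by omega), leafWord_of_le le_rfl]
    simpa [wordDist] using wordDist_leafWord_last_two (m + 1)
  have hright := wordDist_le_of_length (h := m + 4)
    (x := false :: leafWord (m + 3) (2 ^ (m + 2) - 1)) (y := true :: algWord (m + 2) [])
    (by simp [length_leafWord]) (by simp [algWord, length_leafWord])
  rw [← algCost] at hupd ⊢
  omega

theorem algCost_zero : algCost 0 = 0 := by
  simp [algCost, placementCost, words]

/-- Solution of the recursive bounds: the cost is at most
`(29 * 2 ^ k - 12 * k - 27 + (-1) ^ k) / 3`. -/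
theorem algCost_le (k : ℕ) (hk : 1 ≤ k) :
    (Even k → 3 * algCost k + 12 * k + 26 ≤ 29 * 2 ^ k) ∧
      (Odd k → 3 * algCost k + 12 * k + 28 ≤ 29 * 2 ^ k) := by
  induction k, hk using Nat.le_induction with
  | base =>
    have := algCost_succ_le_of_not (k := 0) (by omega)
    rw [algCost_zero, zero_add] at this
    refine ⟨fun h => absurd h (by decide), fun _ => by omega⟩
  | succ k hk ih =>
    rw [pow_succ]
    constructor
    · intro h
      have h1 := ih.2 (by rw [Nat.even_iff] at h; rw [Nat.odd_iff]; omega)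
      have h2 := algCost_succ_le_of_not (k := k) (fun h' => Nat.not_odd_iff_even.2 h h'.1)
      omega
    · intro h
      have h1 := ih.1 (by rw [Nat.odd_iff] at h; rw [Nat.even_iff]; omega)
      have h2 := algCost_succ_le_of_odd (k := k) h (by rw [Nat.odd_iff] at h; omega)
      omega

/-! ### Comparison of the two bounds -/

/-- For `s ≥ 3` the factor `2 ^ (s + 1) / (2 ^ (s + 1) - 1)` is at most `16 / 15`. -/
theorem card_transversal_le {k s : ℕ} (hs : 3 ≤ s) (hsk : s ≤ k) :
    15 * (transversal k s).card ≤ 16 * 2 ^ (k - s) := by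
  have h := card_transversal k s
  have hpos := Nat.one_le_two_pow (n := (k + 1) % (s + 1))
  have h16 : 2 ^ 4 ≤ 2 ^ (s + 1) := Nat.pow_le_pow_right (by norm_num) (by omega)
  have hk : 2 ^ (k + 1) = 2 ^ (k - s) * 2 ^ (s + 1) := by rw [← pow_add]; congr 1; omega
  rw [hk] at h
  generalize 2 ^ (s + 1) = B at *
  generalize 2 ^ (k - s) = A at *
  generalize (transversal k s).card = c at *
  by_contra! hlt
  nlinarith

/-- The cuts into parts of size at least `8`, where the uniform bound `card_transversal_le` is
used in place of the exact size of the transversal. -/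
theorem le_sum_cutCount {k m : ℕ} (hkm : k = m + 2) {F : List Bool → List Bool}
    (hF : ∀ w ∈ words k, (F w).length = k + 1)
    (hinj : ∀ v ∈ words k, ∀ w ∈ words k, F v = F w → v = w) (i : ℕ) (hi : i ≤ m) :
    44 * 2 ^ i ≤ 15 * ∑ j ∈ Finset.range i, cutCount k F (j + 1) + 30 * i + 44 := by
  induction i with
  | zero => simp
  | succ i ih =>
    have h1 := ih (by omega)
    have h2 := le_cutCount (j := i + 1) (s := k - i) (by omega) (by omega) hF hinj
    have h3 := card_transversal_le (k := k) (s := k - i) (by omega) (by omega)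
    rw [show k - (k - i) = i by omega] at h3
    rw [Finset.sum_range_succ, pow_succ]
    rw [pow_succ] at h2
    omega

theorem algCost_le_mul_sum_cutCount {k : ℕ} (hk : 1 ≤ k) {F : List Bool → List Bool}
    (hF : ∀ w ∈ words k, (F w).length = k + 1)
    (hinj : ∀ v ∈ words k, ∀ w ∈ words k, F v = F w → v = w) :
    200 * algCost k ≤ 203 * (2 * ∑ j ∈ Finset.range (k + 1), cutCount k F (j + 1)) := by
  have hA := algCost_le k hk
  have hfull := cutCount_full hF hinj
  have h1 := le_cutCount (j := k) (s := 1) le_rfl rfl hF hinj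
  have hS1 := card_transversal k 1
  rcases k with _ | _ | m
  · omega
  · have := hA.2 (by decide)
    norm_num at this hS1 h1 hfull
    simp only [Finset.sum_range_succ, Finset.sum_range_zero]
    norm_num
    omega
  · -- The cuts into parts of size `2` and `4` are bounded separately: were `16 / 15` replaced by
    -- the factor `8 / 7` of the case `s = 2`, the leading terms would leave no slack at all.
    have h2 := le_cutCount (j := m + 1) (s := 2) (by omega) rfl hF hinj
    have hS2 := card_transversal (m + 2) 2
    have hS2' := Nat.one_le_two_pow (n := (m + 2 + 1) % (2 + 1))
    have h3 := le_sum_cutCount rfl hF hinj m le_rfl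
    have hZ := Nat.lt_two_pow_self (n := m)
    rw [Finset.sum_range_succ, Finset.sum_range_succ, Finset.sum_range_succ]
    have p1 : 2 ^ (m + 1) = 2 * 2 ^ m := by rw [pow_succ]; ring
    have p2 : 2 ^ (m + 2) = 4 * 2 ^ m := by rw [pow_succ, pow_succ]; ring
    have p3 : 2 ^ (m + 2 + 1) = 8 * 2 ^ m := by rw [pow_succ, p2]; ring
    simp only [show m + 1 + 1 = m + 2 from rfl] at *
    rw [p2] at hA h1
    rw [p3] at hfull hS1 hS2
    rw [p1] at h2
    rcases Nat.even_or_odd (m + 2) with he | ho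
    · have hA := hA.1 he
      have hmod : (m + 2 + 1) % (1 + 1) = 1 := by rw [Nat.even_iff] at he; omega
      rw [hmod] at hS1
      omega
    · have hA := hA.2 ho
      have hmod : (m + 2 + 1) % (1 + 1) = 0 := by rw [Nat.odd_iff] at ho; omega
      rw [hmod] at hS1
      omega

theorem theorem23 (hG : ℕ) (hG_pos : 1 ≤ hG) :
    IsArrangement (phiA hG) ∧
      ∀ φ : BTVertex hG → BTVertex (hG + 1), IsArrangement φ →
        (OV (phiA hG) : ℝ) ≤ 203 / 200 * (OV φ : ℝ) := by
  refine ⟨isArrangement_phiA hG, fun φ hφ => ?_⟩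
  have hF : ∀ w ∈ words hG, (wordPlacement φ w).length = hG + 1 := fun w hw => by
    rw [wordPlacement, dif_pos (mem_words.1 hw)]
    exact hφ.2 _
  have hinj : ∀ v ∈ words hG, ∀ w ∈ words hG,
      wordPlacement φ v = wordPlacement φ w → v = w := fun v hv w hw h => by
    rw [wordPlacement, wordPlacement, dif_pos (mem_words.1 hv), dif_pos (mem_words.1 hw)] at h
    exact congrArg Subtype.val (hφ.1 (Subtype.ext h))
  have h := algCost_le_mul_sum_cutCount hG_pos hF hinj
  rw [← placementCost_eq_sum_cutCount hF, ← OV_eq_placementCost, ← OV_phiA] at h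
  have h' : (200 : ℝ) * OV (phiA hG) ≤ 203 * OV φ := by exact_mod_cast h
  linarith
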